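/- Let $M$ be a finite-dimensional smooth manifold. For a manifold $Q$ let $\pi_Q:T^*Q\to Q$ be the cotangent bundle, $\theta_Q$ the Liouville one-form, $\langle(\theta_Q)_\varepsilon,X\rangle=\langle\varepsilon,T\pi_Q X\rangle$, and $\omega_Q=-\mathrm d\theta_Q$. Put $\Omega=pr_1^*\omega_M-pr_0^*\omega_M$ on $T^*M\times T^*M$, where $pr_0,pr_1$ are the two projections onto $T^*M$, and let $$\Upsilon:T^*(M\times M)\to T^*M\times T^*M,\qquad (\gamma_{q_0},\gamma_{q_1})\mapsto(-\gamma_{q_0},\gamma_{q_1}).$$ For an embedded submanifold $C\subset Q$ and a smooth function $f:C\to\mathbb R$ put $$\Sigma_f=\{\mu\in T^*Q\;:\;\pi_Q(\mu)\in C,\ \langle\mu,v\rangle=\langle \mathrm df,v\rangle\ \text{ for all } v\in T_{\pi_Q(\mu)}C\}.$$ Let $\Lambda$ be a Lagrangian submanifold of $(T^*M\times T^*M,\Omega)$, that is, an embedded submanifold to which $\Omega$ restricts to $0$ and whose dimension is half of $\dim(T^*M\times T^*M)$. Let $N=\Upsilon^{-1}(\Lambda)\subset T^*(M\times M)$, with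 inclusion $i_N$. Assume that $N$ has a global generating function for the Liouville form, that is, a smooth function $S:N\to\mathbb R$ with $i_N^*\theta_{M\times M}=\mathrm dS$. Assume also that $\pi_{M\times M}|_N$ is a submersion with connected fibres onto an embedded submanifold $C_d\subset M\times M$. Then $S$ descends to a discrete Lagrangian: there is a smooth function $L_d:C_d\to\mathbb R$ with $S=L_d\circ\pi_{M\times M}|_N$, and $N\subseteq\Sigma_{L_d}$. If moreover, for every $q\in M\times M$, the set $N\cap T_q^*(M\times M)$ is closed in $T_q^*(M\times M)$ (for example, if $\Lambda$ is a closed subset of $T^*M\times T^*M$), then $$\Upsilon^{-1}(\Lambda)=\Sigma_{L_d},\qquad\text{and hence}\qquad \Lambda=\Upsilon(\Sigma_{L_d}).$$ In this case $\Lambda$ is the dynamics of the discrete constrained variational problem $(C_d,L_d)$, whose solutions are the sequences $\gamma_0,\gamma_1,\dots$ in $T^*M$ with $(\gamma_i,\gamma_{i+1})\in\Upsilon(\Sigma_{L_d})$ for all $i$. -/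

import Mathlib

open Bundle Set Manifold
open scoped ContDiff

noncomputable section

namespace DiscreteMechanics

section Forms

variable {E : Type*} [NormedAddCommGroup E] [NormedSpace ℝ E] {H : Type*} [TopologicalSpace H]
  (I : ModelWithCorners ℝ E H) {P : Type*} [TopologicalSpace P] [ChartedSpace H P]

/-- Exterior derivative `dα` of a one-form `α` on a manifold without boundary. In the preferred
chart `φ` around `x`, with `a` the coordinate expression of `α`,
`dα(u, v) = (D a · u) v - (D a · v) u`. -/
def extDerivOneForm (α : ∀ x : P, TangentSpace I x →L[ℝ] ℝ) (x : P) (u v : TangentSpace I x) : ℝ :=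
  let a : E → E →L[ℝ] ℝ := fun y =>
    (α ((extChartAt I x).symm y)).comp (mfderiv 𝓘(ℝ, E) I (extChartAt I x).symm y)
  let u' : E := mfderiv I 𝓘(ℝ, E) (extChartAt I x) x u
  let v' : E := mfderiv I 𝓘(ℝ, E) (extChartAt I x) x v
  fderiv ℝ a (extChartAt I x x) u' v' - fderiv ℝ a (extChartAt I x x) v' u'

/-- `ι : L → P` is (the inclusion of) a Lagrangian submanifold of `P` for the two-form `Ω`:
an embedded submanifold with `ι^* Ω = 0` and `dim L = (1/2) dim P`. -/
structure IsLagrangianSubmanifold (Ω : ∀ x : P, TangentSpace I x → TangentSpace I x → ℝ)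
    (G : Type*) [NormedAddCommGroup G] [NormedSpace ℝ G]
    {L : Type*} [TopologicalSpace L] [ChartedSpace G L] (ι : L → P) : Prop where
  isSmoothEmbedding : IsSmoothEmbedding 𝓘(ℝ, G) I ∞ ι
  isotropic : ∀ (x : L) (u v : TangentSpace 𝓘(ℝ, G) x),
    Ω (ι x) (mfderiv 𝓘(ℝ, G) I ι x u) (mfderiv 𝓘(ℝ, G) I ι x v) = 0
  two_mul_dim : 2 * Module.finrank ℝ G = Module.finrank ℝ E

end Forms

section Cotangent

variable {E : Type*} [NormedAddCommGroup E] [NormedSpace ℝ E] {H : Type*} [TopologicalSpace H]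
  (I : ModelWithCorners ℝ E H)

/-- The cotangent bundle `T^*Q`, with Mathlib's topology and manifold structure on the bundle of
continuous linear maps from the tangent bundle to `ℝ`. Its projection `π_Q` is
`Bundle.TotalSpace.proj`. -/
abbrev CotangentBundle (Q : Type*) [TopologicalSpace Q] [ChartedSpace H Q] [IsManifold I ∞ Q] :
    Type _ :=
  TotalSpace (E →L[ℝ] ℝ) (fun q : Q => TangentSpace I q →L[ℝ] ℝ)

/-- The model with corners of the cotangent bundle. -/
abbrev cotangentModel : ModelWithCorners ℝ (E × (E →L[ℝ] ℝ)) (ModelProd H (E →L[ℝ] ℝ)) :=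
  I.prod 𝓘(ℝ, E →L[ℝ] ℝ)

variable {Q : Type*} [TopologicalSpace Q] [ChartedSpace H Q] [IsManifold I ∞ Q]

/-- The Liouville one-form `θ_Q` on `T^*Q`: `⟨θ_ε, X⟩ = ⟨ε, Tπ_Q X⟩`. -/
def liouville (ε : CotangentBundle I Q) : TangentSpace (cotangentModel I) ε →L[ℝ] ℝ :=
  ε.2.comp (mfderiv (cotangentModel I) I
    (TotalSpace.proj : CotangentBundle I Q → Q) ε)

/-- The canonical symplectic form `ω_Q = -dθ_Q` on `T^*Q`. -/
def canonicalForm (ε : CotangentBundle I Q) (X Y : TangentSpace (cotangentModel I) ε) : ℝ :=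
  -extDerivOneForm (cotangentModel I) (liouville I (Q := Q)) ε X Y

/-- The form `Ω = pr₁^* ω_Q - pr₀^* ω_Q` on `T^*Q × T^*Q`. -/
def productForm (z : CotangentBundle I Q × CotangentBundle I Q)
    (X Y : TangentSpace ((cotangentModel I).prod (cotangentModel I)) z) : ℝ :=
  canonicalForm I z.2
      (mfderiv ((cotangentModel I).prod (cotangentModel I)) (cotangentModel I) Prod.snd z X)
      (mfderiv ((cotangentModel I).prod (cotangentModel I)) (cotangentModel I) Prod.snd z Y)
    - canonicalForm I z.1
      (mfderiv ((cotangentModel I).prod (cotangentModel I)) (cotangentModel I) Prod.fst z X)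
      (mfderiv ((cotangentModel I).prod (cotangentModel I)) (cotangentModel I) Prod.fst z Y)

/-- `S : N → ℝ` is a (global) generating function, for the Liouville form, of the submanifold
of `T^*Q` with inclusion `i : N → T^*Q`: it is smooth and `i^* θ_Q = dS`. -/
def IsGeneratingFunction (G : Type*) [NormedAddCommGroup G] [NormedSpace ℝ G]
    {N : Type*} [TopologicalSpace N] [ChartedSpace G N]
    (i : N → CotangentBundle I Q) (S : N → ℝ) : Prop :=
  ContMDiff 𝓘(ℝ, G) 𝓘(ℝ, ℝ) ∞ S ∧
    ∀ (x : N) (v : TangentSpace 𝓘(ℝ, G) x),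
      liouville I (i x) (mfderiv 𝓘(ℝ, G) (cotangentModel I) i x v)
        = mfderiv 𝓘(ℝ, G) 𝓘(ℝ, ℝ) S x v

/-- For a submanifold `j : C → Q` and a function `f : C → ℝ`, the subset `Σ_f` of `T^*Q`
of the covectors `μ` at points `j c` of `C` such that `⟨μ, v⟩ = ⟨df, v⟩` for all `v ∈ T_c C`. -/
def sigma (F : Type*) [NormedAddCommGroup F] [NormedSpace ℝ F]
    {C : Type*} [TopologicalSpace C] [ChartedSpace F C]
    (j : C → Q) (f : C → ℝ) : Set (CotangentBundle I Q) :=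
  {γ | ∃ (c : C) (μ : TangentSpace I (j c) →L[ℝ] ℝ), γ = ⟨j c, μ⟩ ∧
    ∀ v : TangentSpace 𝓘(ℝ, F) c,
      μ (mfderiv 𝓘(ℝ, F) I j c v) = mfderiv 𝓘(ℝ, F) 𝓘(ℝ, ℝ) f c v}

end Cotangent

section Upsilon

variable {E : Type*} [NormedAddCommGroup E] [NormedSpace ℝ E] {H : Type*} [TopologicalSpace H]
  (I : ModelWithCorners ℝ E H)
  (M : Type*) [TopologicalSpace M] [ChartedSpace H M] [IsManifold I ∞ M]

/-- The bijection `Υ : T^*(M × M) → T^*M × T^*M`, `(γ_{q₀}, γ_{q₁}) ↦ (-γ_{q₀}, γ_{q₁})`, where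
`γ_{q₀}` and `γ_{q₁}` are the restrictions of `γ` to the two factors of
`T_{(q₀, q₁)}(M × M) = T_{q₀} M × T_{q₁} M`. -/
def upsilon : CotangentBundle (I.prod I) (M × M) ≃ CotangentBundle I M × CotangentBundle I M where
  toFun γ :=
    (⟨γ.1.1, -(γ.2.comp
      (ContinuousLinearMap.inl ℝ (TangentSpace I γ.1.1) (TangentSpace I γ.1.2)))⟩,
     ⟨γ.1.2, γ.2.comp
      (ContinuousLinearMap.inr ℝ (TangentSpace I γ.1.1) (TangentSpace I γ.1.2))⟩)
  invFun z := ⟨(z.1.1, z.2.1), ContinuousLinearMap.coprod (-z.1.2) z.2.2⟩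
  left_inv := by
    rintro ⟨⟨q₀, q₁⟩, γ⟩
    refine congrArg (TotalSpace.mk (q₀, q₁)) ?_
    refine ContinuousLinearMap.ext fun v => ?_
    obtain ⟨v₀, v₁⟩ := v
    change -(-(γ (v₀, 0))) + γ (0, v₁) = γ (v₀, v₁)
    rw [neg_neg]
    refine (γ.map_add (v₀, 0) (0, v₁)).symm.trans (congrArg γ ?_)
    exact Prod.ext (add_zero v₀) (zero_add v₁)
  right_inv := by
    rintro ⟨⟨q₀, α⟩, ⟨q₁, β⟩⟩
    refine Prod.ext (congrArg (TotalSpace.mk q₀) ?_) (congrArg (TotalSpace.mk q₁) ?_)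
    · refine ContinuousLinearMap.ext fun v => ?_
      change -(-(α v) + β 0) = α v
      rw [map_zero, add_zero, neg_neg]
    · refine ContinuousLinearMap.ext fun v => ?_
      change -(α 0) + β v = β v
      rw [map_zero, neg_zero, zero_add]

variable {M}

/-- The dynamics `Υ(Σ_{L_d}) ⊆ T^*M × T^*M` of the discrete constrained variational problem with
constraint submanifold `j : C → M × M` and discrete Lagrangian `Ld : C → ℝ`; its solutions are the
sequences `γ₀, γ₁, …` in `T^*M` whose consecutive pairs lie in this set. -/
def discreteDynamics (F : Type*) [NormedAddCommGroup F] [NormedSpace ℝ F]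
    {C : Type*} [TopologicalSpace C] [ChartedSpace F C]
    (j : C → M × M) (Ld : C → ℝ) : Set (CotangentBundle I M × CotangentBundle I M) :=
  upsilon I M '' sigma (I.prod I) F j Ld

end Upsilon

end DiscreteMechanics

end

/-!
Let `i : N → T^*Q` and `j : C_d → Q` be the inclusions and `p = π_Q|_N`. By the definition of the
Liouville form, `dS(v) = ⟨i x, Tj (Tp v)⟩`. Hence `dS` vanishes on vertical vectors, `S` is constant
on the connected fibres of `p`, and local sections of `p` show that the descended function `L_d` is
smooth. Since `Tp` is onto, the same identity says that `N` is contained in `Σ_{L_d}`.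

Over a point of `C_d` the set `Σ_{L_d}` is the affine space of covectors extending `dL_d`, whose
dimension is `dim Q - dim C_d`, the dimension of a fibre of `p`. By the inverse function theorem the
fibre of `N` is open in this affine space. If it is also closed, it is everything.
-/

namespace DiscreteMechanics

open scoped Topology
open Filter Function

section Preconnected

theorem subset_of_isPreconnected_of_isClosed {X : Type*} [TopologicalSpace X] {A B : Set X}
    (hA : IsPreconnected A) (hB : IsClosed B) (hne : (A ∩ B).Nonempty)
    (hopen : ∀ x ∈ A ∩ B, B ∈ 𝓝[A] x) : A ⊆ B := by
  obtain ⟨a, haA, haB⟩ := hne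
  intro x hx
  refine (hA.induction₂ (fun y z => y ∈ B ↔ z ∈ B) (fun y hy => ?_)
    (fun _ _ _ _ _ _ => Iff.trans) (fun _ _ _ _ => Iff.symm) haA hx).1 haB
  by_cases hyB : y ∈ B
  · filter_upwards [hopen y ⟨hy, hyB⟩] with z hz using iff_of_true hyB hz
  · filter_upwards [mem_nhdsWithin_of_mem_nhds (hB.isOpen_compl.mem_nhds hyB)] with z hz
      using iff_of_false hyB hz

end Preconnected

section LinearAlgebra

theorem finrank_continuousDual (V : Type*) [NormedAddCommGroup V] [NormedSpace ℝ V]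
    [FiniteDimensional ℝ V] : Module.finrank ℝ (V →L[ℝ] ℝ) = Module.finrank ℝ V :=
  (LinearMap.toContinuousLinearMap (𝕜 := ℝ) (E := V) (F' := ℝ)).finrank_eq.symm.trans
    Subspace.dual_finrank_eq

theorem surjective_precomp {𝕜 E F G : Type*} [NontriviallyNormedField 𝕜]
    [NormedAddCommGroup E] [NormedSpace 𝕜 E] [NormedAddCommGroup F] [NormedSpace 𝕜 F]
    [NormedAddCommGroup G] [NormedSpace 𝕜 G] {T : F →L[𝕜] E} (hT : T.HasLeftInverse) :
    Surjective (ContinuousLinearMap.precomp G T : (E →L[𝕜] G) →L[𝕜] F →L[𝕜] G) := fun ν =>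
  ⟨ν.comp hT.leftInverse, ContinuousLinearMap.ext fun v =>
    congrArg ν (hT.leftInverse_leftInverse v)⟩

theorem surjective_coprod_of_finrank_add_finrank_eq {𝕜 K V W : Type*} [Field 𝕜]
    [AddCommGroup K] [Module 𝕜 K] [FiniteDimensional 𝕜 K]
    [AddCommGroup V] [Module 𝕜 V] [FiniteDimensional 𝕜 V]
    [AddCommGroup W] [Module 𝕜 W] [FiniteDimensional 𝕜 W]
    {D : K →ₗ[𝕜] V} {R : V →ₗ[𝕜] W} {s : W →ₗ[𝕜] V} (hD : Injective D)
    (hRD : ∀ v, R (D v) = 0) (hRs : LeftInverse R s)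
    (hdim : Module.finrank 𝕜 K + Module.finrank 𝕜 W = Module.finrank 𝕜 V) :
    Surjective (D.coprod s) := by
  have hinj : Injective (D.coprod s) := by
    refine (injective_iff_map_eq_zero _).2 fun ⟨v, w⟩ h => ?_
    rw [LinearMap.coprod_apply] at h
    obtain rfl : w = 0 := by simpa [hRD, hRs w] using congrArg R h
    rw [map_zero, add_zero] at h
    exact Prod.ext ((map_eq_zero_iff D hD).1 h) rfl
  exact (LinearMap.injective_iff_surjective_of_finrank_eq_finrank
    (by rw [Module.finrank_prod, hdim])).1 hinj

theorem nhdsWithin_preimage_le_map_of_hasStrictFDerivAt {𝕜 K V W : Type*}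
    [NontriviallyNormedField 𝕜] [CompleteSpace 𝕜]
    [NormedAddCommGroup K] [NormedSpace 𝕜 K]
    [NormedAddCommGroup V] [NormedSpace 𝕜 V] [FiniteDimensional 𝕜 V]
    [NormedAddCommGroup W] [NormedSpace 𝕜 W]
    {φ : K → V} {D : K →L[𝕜] V} {k₀ : K} (hφ : HasStrictFDerivAt φ D k₀) (hD : Injective D)
    {R : V →L[𝕜] W} (hR : Surjective R) (hRφ : ∀ᶠ k in 𝓝 k₀, R (φ k) = R (φ k₀))
    (hdim : Module.finrank 𝕜 K + Module.finrank 𝕜 W = Module.finrank 𝕜 V) :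
    𝓝[R ⁻¹' {R (φ k₀)}] (φ k₀) ≤ map φ (𝓝 k₀) := by
  have : FiniteDimensional 𝕜 K := Module.Finite.of_injective D.toLinearMap hD
  have : FiniteDimensional 𝕜 W := Module.Finite.of_surjective R.toLinearMap hR
  have : CompleteSpace K := FiniteDimensional.complete 𝕜 K
  have : CompleteSpace W := FiniteDimensional.complete 𝕜 W
  have : CompleteSpace V := FiniteDimensional.complete 𝕜 V
  have hRinv := ContinuousLinearMap.HasRightInverse.of_surjective_of_finiteDimensional hR
  let s : W →L[𝕜] V := hRinv.rightInverse
  have hRs : LeftInverse R s := hRinv.rightInverse_rightInverse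
  have hRD (v : K) : R (D v) = 0 := by
    have h := (hasFDerivAt_const (𝕜 := 𝕜) (R (φ k₀)) k₀).congr_of_eventuallyEq hRφ
    exact DFunLike.congr_fun ((R.hasFDerivAt.comp k₀ hφ.hasFDerivAt).unique h) v
  -- `Φ` is a local diffeomorphism extending `φ`, with `R (Φ (k, w)) = R (φ k₀) + w`
  let Φ : K × W → V := fun z => φ z.1 + s z.2
  have hΦ : HasStrictFDerivAt Φ (D.coprod s) (k₀, 0) :=
    (hφ.comp (k₀, (0 : W)) hasStrictFDerivAt_fst).add
      (s.hasStrictFDerivAt.comp (k₀, (0 : W)) hasStrictFDerivAt_snd)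
  have hmap : map Φ (𝓝 (k₀, 0)) = 𝓝 (φ k₀) := by
    have hsurj : Surjective (D.coprod s) :=
      surjective_coprod_of_finrank_add_finrank_eq (R := R.toLinearMap) hD hRD hRs hdim
    simpa [Φ] using hΦ.map_nhds_eq_of_surj (LinearMap.range_eq_top.2 hsurj)
  intro U hU
  have hU' : ∀ᶠ k in 𝓝 k₀, φ k ∈ U := hU
  rw [mem_nhdsWithin_iff_eventually, ← hmap, eventually_map]
  filter_upwards [hRφ.prod_inl_nhds (0 : W), hU'.prod_inl_nhds (0 : W)] with z hRz hzU hz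
  have hz₂ : z.2 = 0 := by simpa [Φ, hRz, hRs z.2] using hz
  simpa [Φ, hz₂] using hzU

end LinearAlgebra

section Charts

variable {𝕜 : Type*} [NontriviallyNormedField 𝕜]
  {E : Type*} [NormedAddCommGroup E] [NormedSpace 𝕜 E] {H : Type*} [TopologicalSpace H]
  {I : ModelWithCorners 𝕜 E H} {M : Type*} [TopologicalSpace M] [ChartedSpace H M]
  {n : WithTop ℕ∞} {e : OpenPartialHomeomorph M H} {x : M}

theorem isLocalDiffeomorphAt_of_mem_maximalAtlas (he : e ∈ IsManifold.maximalAtlas I n M)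
    (hx : x ∈ e.source) : IsLocalDiffeomorphAt I I n e x :=
  ⟨⟨e.toPartialEquiv, e.open_source, e.open_target, contMDiffOn_of_mem_maximalAtlas he,
    contMDiffOn_symm_of_mem_maximalAtlas he⟩, hx, eqOn_refl _ _⟩

end Charts

section Immersion

variable {𝕜 : Type*} [NontriviallyNormedField 𝕜]
  {E₁ : Type*} [NormedAddCommGroup E₁] [NormedSpace 𝕜 E₁] {H₁ : Type*} [TopologicalSpace H₁]
  {I₁ : ModelWithCorners 𝕜 E₁ H₁} {M₁ : Type*} [TopologicalSpace M₁] [ChartedSpace H₁ M₁]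
  {E₂ : Type*} [NormedAddCommGroup E₂] [NormedSpace 𝕜 E₂] {H₂ : Type*} [TopologicalSpace H₂]
  {I₂ : ModelWithCorners 𝕜 E₂ H₂} {M₂ : Type*} [TopologicalSpace M₂] [ChartedSpace H₂ M₂]
  {E₃ : Type*} [NormedAddCommGroup E₃] [NormedSpace 𝕜 E₃] {H₃ : Type*} [TopologicalSpace H₃]
  {I₃ : ModelWithCorners 𝕜 E₃ H₃} {M₃ : Type*} [TopologicalSpace M₃] [ChartedSpace H₃ M₃]
  {n : WithTop ℕ∞} {g : M₂ → M₃} {f : M₁ → M₂} {x : M₁}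

theorem injective_mfderiv_of_comp (hg : MDifferentiableAt I₂ I₃ g (f x))
    (hf : MDifferentiableAt I₁ I₂ f x) (h : Injective (mfderiv I₁ I₃ (g ∘ f) x)) :
    Injective (mfderiv I₁ I₂ f x) := by
  rw [mfderiv_comp x hg hf] at h
  exact Injective.of_comp (f := mfderiv I₂ I₃ g (f x)) h

theorem surjective_mfderiv_of_comp (hg : MDifferentiableAt I₂ I₃ g (f x))
    (hf : MDifferentiableAt I₁ I₂ f x) (h : Surjective (mfderiv I₁ I₃ (g ∘ f) x)) :
    Surjective (mfderiv I₂ I₃ g (f x)) := by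
  rw [mfderiv_comp x hg hf] at h
  exact Surjective.of_comp (g := mfderiv I₁ I₂ f x) h

theorem injective_mfderiv_of_isImmersionAt {G : Type*} [NormedAddCommGroup G] [NormedSpace 𝕜 G]
    {L : Type*} [TopologicalSpace L] [ChartedSpace G L] {f : L → M₁} {x : L}
    (hf : IsImmersionAt 𝓘(𝕜, G) I₁ n f x) (hn : n ≠ 0) :
    Injective (mfderiv 𝓘(𝕜, G) I₁ f x) := by
  let g : M₁ → G := (fun w => (hf.equiv.symm w).1) ∘ hf.codChart.extend I₁
  have hg : MDifferentiableAt I₁ 𝓘(𝕜, G) g (f x) := by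
    have hext : MDifferentiableAt I₁ 𝓘(𝕜, E₁) (hf.codChart.extend I₁) (f x) :=
      ((OpenPartialHomeomorph.contMDiffOn_extend hf.codChart_mem_maximalAtlas).contMDiffAt
        (hf.codChart.open_source.mem_nhds hf.mem_codChart_source)).mdifferentiableAt hn
    have hfst : Differentiable 𝕜 fun w => (hf.equiv.symm w).1 :=
      differentiable_fst.comp hf.equiv.symm.differentiable
    exact (hfst.mdifferentiable _).comp _ hext
  have hgf : g ∘ f =ᶠ[𝓝 x] hf.domChart := by
    filter_upwards [hf.domChart.open_source.mem_nhds hf.mem_domChart_source] with y hy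
    have hy' := hf.writtenInCharts (show hf.domChart y ∈ _ by simp [hy])
    simp only [comp_apply, OpenPartialHomeomorph.extend_coe_symm,
      modelWithCornersSelf_coe_symm, id_eq, hf.domChart.left_inv hy] at hy'
    simp only [g, comp_apply, hy', ContinuousLinearEquiv.symm_apply_apply]
  have hchart := isLocalDiffeomorphAt_of_mem_maximalAtlas hf.domChart_mem_maximalAtlas
    hf.mem_domChart_source
  refine injective_mfderiv_of_comp hg (hf.contMDiffAt.mdifferentiableAt hn) ?_
  rw [hgf.mfderiv_eq, ← hchart.mfderivToContinuousLinearEquiv_coe hn]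
  exact (hchart.mfderivToContinuousLinearEquiv hn).injective

end Immersion

section Submersion

variable {𝕜 : Type*} [NontriviallyNormedField 𝕜]
  {G : Type*} [NormedAddCommGroup G] [NormedSpace 𝕜 G]
  {L : Type*} [TopologicalSpace L] [ChartedSpace G L]
  {F : Type*} [NormedAddCommGroup F] [NormedSpace 𝕜 F]
  {C : Type*} [TopologicalSpace C] [ChartedSpace F C]
  {K : Type*} [NormedAddCommGroup K] [NormedSpace 𝕜 K]
  {n : WithTop ℕ∞} {p : L → C} {x : L}

theorem exists_isLocalDiffeomorphAt_prodMk
    (hp : IsSubmersionAtOfComplement K 𝓘(𝕜, G) 𝓘(𝕜, F) n p x) :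
    ∃ κ : L → K,
      IsLocalDiffeomorphAt 𝓘(𝕜, G) (𝓘(𝕜, F).prod 𝓘(𝕜, K)) n (fun y => (p y, κ y)) x := by
  let φ : OpenPartialHomeomorph L (F × K) := hp.domChart.transHomeomorph hp.equiv.toHomeomorph
  let ψ : OpenPartialHomeomorph (C × K) (F × K) := hp.codChart.prod (OpenPartialHomeomorph.refl K)
  have hpφ (y : L) (hy : y ∈ hp.domChart.source) : hp.codChart (p y) = (φ y).1 := by
    have hpy := hp.writtenInCharts (show hp.domChart y ∈ _ by simp [hy])
    simp only [comp_apply, OpenPartialHomeomorph.extend_coe,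
      OpenPartialHomeomorph.extend_coe_symm, modelWithCornersSelf_coe,
      modelWithCornersSelf_coe_symm, id_eq, hp.domChart.left_inv hy] at hpy
    exact hpy
  have hΘ (y : L) (hy : y ∈ hp.domChart.source) : (φ.trans ψ.symm) y = (p y, (φ y).2) := by
    change (hp.codChart.symm (φ y).1, (φ y).2) = _
    rw [← hpφ y hy, hp.codChart.left_inv (hp.mapsto_domChart_source_codChart_source hy)]
  have hφ : ContMDiffOn 𝓘(𝕜, G) 𝓘(𝕜, F × K) n φ φ.source :=
    hp.equiv.contDiff.contMDiff.comp_contMDiffOn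
      (contMDiffOn_of_mem_maximalAtlas hp.domChart_mem_maximalAtlas)
  have hφ_symm : ContMDiffOn 𝓘(𝕜, F × K) 𝓘(𝕜, G) n φ.symm φ.target :=
    (contMDiffOn_symm_of_mem_maximalAtlas hp.domChart_mem_maximalAtlas).comp
      hp.equiv.symm.contDiff.contMDiff.contMDiffOn fun _ hz => hz
  have hψ : ContMDiffOn (𝓘(𝕜, F).prod 𝓘(𝕜, K)) 𝓘(𝕜, F × K) n ψ ψ.source :=
    ((contMDiffOn_of_mem_maximalAtlas hp.codChart_mem_maximalAtlas).comp contMDiffOn_fst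
      fun _ hz => hz.1).prodMk_space contMDiffOn_snd
  refine ⟨fun y => (φ y).2, ⟨⟨(φ.trans ψ.symm).toPartialEquiv, (φ.trans ψ.symm).open_source,
    (φ.trans ψ.symm).open_target, ?_, ?_⟩, ?_, fun y hy => (hΘ y hy.1).symm⟩⟩
  · exact ((hp.contMDiffOn.mono fun y hy => hy.1).prodMk
      (contDiff_snd.contMDiff.comp_contMDiffOn (hφ.mono fun y hy => hy.1))).congr
        fun y hy => hΘ y hy.1
  · exact hφ_symm.comp (hψ.mono fun z hz => hz.1) fun z hz => hz.2
  · refine ⟨hp.mem_domChart_source, ?_, mem_univ _⟩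
    change (φ x).1 ∈ hp.codChart.target
    rw [← hpφ x hp.mem_domChart_source]
    exact hp.codChart.map_source hp.mem_codChart_source

theorem exists_local_section (hp : IsSubmersionAtOfComplement K 𝓘(𝕜, G) 𝓘(𝕜, F) n p x) :
    ∃ s : C → L, s (p x) = x ∧ ContMDiffAt 𝓘(𝕜, F) 𝓘(𝕜, G) n s (p x) ∧ p ∘ s =ᶠ[𝓝 (p x)] id := by
  obtain ⟨κ, hκ⟩ := exists_isLocalDiffeomorphAt_prodMk hp
  have hι : ContMDiffAt 𝓘(𝕜, F) (𝓘(𝕜, F).prod 𝓘(𝕜, K)) n (fun c => (c, κ x)) (p x) :=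
    contMDiffAt_id.prodMk contMDiffAt_const
  refine ⟨fun c => hκ.localInverse (c, κ x), ?_, ?_, ?_⟩
  · exact hκ.localInverse_eventuallyEq_left.self_of_nhds
  · exact hκ.localInverse_contMDiffAt.comp (p x) hι
  · filter_upwards [hι.continuousAt.eventually hκ.localInverse_eventuallyEq_right] with c hc
    exact congrArg Prod.fst hc

theorem surjective_mfderiv_of_isSubmersionAtOfComplement
    (hp : IsSubmersionAtOfComplement K 𝓘(𝕜, G) 𝓘(𝕜, F) n p x) (hn : n ≠ 0) :
    Surjective (mfderiv 𝓘(𝕜, G) 𝓘(𝕜, F) p x) := by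
  obtain ⟨s, hsx, hs, hps⟩ := exists_local_section hp
  have hp' : ContMDiffAt 𝓘(𝕜, G) 𝓘(𝕜, F) n p (s (p x)) := hsx.symm ▸ hp.contMDiffAt
  have hsurj : Surjective (mfderiv 𝓘(𝕜, F) 𝓘(𝕜, F) (p ∘ s) (p x)) := by
    rw [hps.mfderiv_eq, mfderiv_id]
    exact surjective_id
  have := surjective_mfderiv_of_comp (hp'.mdifferentiableAt hn) (hs.mdifferentiableAt hn) hsurj
  rwa [hsx] at this

theorem contMDiff_of_comp_isSubmersion {E : Type*} [NormedAddCommGroup E] [NormedSpace 𝕜 E]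
    {H : Type*} [TopologicalSpace H] {I : ModelWithCorners 𝕜 E H} {M : Type*} [TopologicalSpace M]
    [ChartedSpace H M] {g : C → M} (hp : IsSubmersion 𝓘(𝕜, G) 𝓘(𝕜, F) n p)
    (hp_surj : Surjective p) (hg : ContMDiff 𝓘(𝕜, G) I n (g ∘ p)) :
    ContMDiff 𝓘(𝕜, F) I n g := by
  intro c
  obtain ⟨x, rfl⟩ := hp_surj c
  obtain ⟨s, -, hs, hps⟩ := exists_local_section (hp.isSubmersionOfComplement_complement x)
  exact (hg.contMDiffAt.comp (p x) hs).congr_of_eventuallyEq (hps.fun_comp g).symm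

theorem exists_fiber_parametrization
    (hp : IsSubmersionAtOfComplement K 𝓘(𝕜, G) 𝓘(𝕜, F) n p x) (hn : n ≠ 0) :
    ∃ (σ : K → L) (k₀ : K), σ k₀ = x ∧ Injective (mfderiv 𝓘(𝕜, K) 𝓘(𝕜, G) σ k₀) ∧
      (∀ᶠ k in 𝓝 k₀, ContMDiffAt 𝓘(𝕜, K) 𝓘(𝕜, G) n σ k ∧ p (σ k) = p x) ∧
      𝓝[p ⁻¹' {p x}] x ≤ map σ (𝓝 k₀) := by
  obtain ⟨κ, hκ⟩ := exists_isLocalDiffeomorphAt_prodMk hp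
  let σ : K → L := fun k => hκ.localInverse (p x, k)
  have hι (k : K) : ContMDiffAt 𝓘(𝕜, K) (𝓘(𝕜, F).prod 𝓘(𝕜, K)) n (fun k => (p x, k)) k :=
    contMDiffAt_const.prodMk contMDiffAt_id
  have hσ : ∀ᶠ k in 𝓝 (κ x), ContMDiffAt 𝓘(𝕜, K) 𝓘(𝕜, G) n σ k := by
    filter_upwards [(hι (κ x)).continuousAt.eventually
      (hκ.localInverse_open_source.mem_nhds hκ.localInverse_mem_source)] with k hk
    exact (hκ.localInverse_contMDiffOn.contMDiffAt
      (hκ.localInverse_open_source.mem_nhds hk)).comp k (hι k)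
  have hpσ : ∀ᶠ k in 𝓝 (κ x), p (σ k) = p x ∧ κ (σ k) = k := by
    filter_upwards [(hι (κ x)).continuousAt.eventually hκ.localInverse_eventuallyEq_right]
      with k hk using Prod.ext_iff.1 hk
  have hσx : σ (κ x) = x := hκ.localInverse_eventuallyEq_left.self_of_nhds
  have hκ_diff : MDifferentiableAt 𝓘(𝕜, G) 𝓘(𝕜, K) κ x := (hκ.mdifferentiableAt hn).snd
  refine ⟨σ, κ x, hσx, ?_, hσ.and (hpσ.mono fun _ => And.left), fun U hU => ?_⟩
  · refine injective_mfderiv_of_comp (g := κ) (I₃ := 𝓘(𝕜, K)) (hσx.symm ▸ hκ_diff)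
      (hσ.self_of_nhds.mdifferentiableAt hn) ?_
    have hκσ : κ ∘ σ =ᶠ[𝓝 (κ x)] id := hpσ.mono fun _ => And.right
    rw [hκσ.mfderiv_eq, mfderiv_id]
    exact injective_id
  · have hU' : ∀ᶠ k in 𝓝 (κ x), σ k ∈ U := hU
    rw [mem_nhdsWithin_iff_eventually]
    filter_upwards [hκ_diff.continuousAt.eventually hU', hκ.localInverse_eventuallyEq_left]
      with y hyU hy hpy
    have hσy : σ (κ y) = y := (congrArg (fun c => hκ.localInverse (c, κ y)) hpy.symm).trans hy
    rwa [hσy] at hyU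

end Submersion

section Descent

variable {G : Type*} [NormedAddCommGroup G] [NormedSpace ℝ G]
  {L : Type*} [TopologicalSpace L] [ChartedSpace G L]
  {F : Type*} [NormedAddCommGroup F] [NormedSpace ℝ F]
  {C : Type*} [TopologicalSpace C] [ChartedSpace F C]
  {V : Type*} [NormedAddCommGroup V] [NormedSpace ℝ V]
  {n : WithTop ℕ∞} {p : L → C} {f : L → V}

theorem eventually_eq_of_eventually_hasFDerivAt_zero {K : Type*} [NormedAddCommGroup K]
    [NormedSpace ℝ K] {f : K → V} {k₀ : K}
    (hf : ∀ᶠ k in 𝓝 k₀, HasFDerivAt f (0 : K →L[ℝ] V) k) : ∀ᶠ k in 𝓝 k₀, f k = f k₀ := by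
  obtain ⟨r, hr, hball⟩ := Metric.eventually_nhds_iff_ball.1 hf
  filter_upwards [Metric.ball_mem_nhds k₀ hr] with k hk
  exact Metric.isOpen_ball.is_const_of_fderiv_eq_zero (convex_ball k₀ r).isPreconnected
    (fun k hk => (hball k hk).differentiableAt.differentiableWithinAt)
    (fun k hk => (hball k hk).fderiv) hk (Metric.mem_ball_self hr)

theorem eventually_nhdsWithin_fiber_eq (hp : IsSubmersion 𝓘(ℝ, G) 𝓘(ℝ, F) n p) (hn : n ≠ 0)
    (hf : MDifferentiable 𝓘(ℝ, G) 𝓘(ℝ, V) f)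
    (hpf : ∀ x v, mfderiv 𝓘(ℝ, G) 𝓘(ℝ, F) p x v = 0 → mfderiv 𝓘(ℝ, G) 𝓘(ℝ, V) f x v = 0)
    (x : L) : ∀ᶠ y in 𝓝[p ⁻¹' {p x}] x, f y = f x := by
  obtain ⟨σ, k₀, rfl, -, hσ, hle⟩ :=
    exists_fiber_parametrization (hp.isSubmersionOfComplement_complement x) hn
  refine hle (eventually_eq_of_eventually_hasFDerivAt_zero (f := f ∘ σ) ?_)
  filter_upwards [hσ.eventually_nhds] with k hk
  have hσk := (hk.self_of_nhds.1.mdifferentiableAt hn).hasMFDerivAt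
  have hpσ : p ∘ σ =ᶠ[𝓝 k] fun _ => p (σ k₀) := hk.mono fun _ => And.right
  have hvert := (((hp.contMDiff _).mdifferentiableAt hn).hasMFDerivAt.comp k hσk).mfderiv.symm.trans
    (hpσ.mfderiv_eq.trans mfderiv_const)
  have hfσ := ((hf (σ k)).hasMFDerivAt.comp k hσk).hasFDerivAt
  exact hfσ.congr_fderiv (ContinuousLinearMap.ext fun v => hpf _ _ (DFunLike.congr_fun hvert v))

theorem factorsThrough_of_isSubmersion (hp : IsSubmersion 𝓘(ℝ, G) 𝓘(ℝ, F) n p) (hn : n ≠ 0)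
    (hp_conn : ∀ c, IsPreconnected (p ⁻¹' {c})) (hf : MDifferentiable 𝓘(ℝ, G) 𝓘(ℝ, V) f)
    (hpf : ∀ x v, mfderiv 𝓘(ℝ, G) 𝓘(ℝ, F) p x v = 0 → mfderiv 𝓘(ℝ, G) 𝓘(ℝ, V) f x v = 0) :
    f.FactorsThrough p := by
  intro x y hxy
  refine (hp_conn (p x)).induction₂ (fun a b => f a = f b) (fun z hz => ?_)
    (fun _ _ _ _ _ _ => Eq.trans) (fun _ _ _ _ => Eq.symm) rfl hxy.symm
  rw [← (hz : p z = p x)]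
  exact (eventually_nhdsWithin_fiber_eq hp hn hf hpf z).mono fun _ => Eq.symm

theorem exists_contMDiff_descent (hp : IsSubmersion 𝓘(ℝ, G) 𝓘(ℝ, F) n p) (hn : n ≠ 0)
    (hp_surj : Surjective p) (hp_conn : ∀ c, IsPreconnected (p ⁻¹' {c}))
    (hf : ContMDiff 𝓘(ℝ, G) 𝓘(ℝ, V) n f)
    (hpf : ∀ x v, mfderiv 𝓘(ℝ, G) 𝓘(ℝ, F) p x v = 0 → mfderiv 𝓘(ℝ, G) 𝓘(ℝ, V) f x v = 0) :
    ∃ g : C → V, ContMDiff 𝓘(ℝ, F) 𝓘(ℝ, V) n g ∧ f = g ∘ p := by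
  obtain ⟨g, rfl⟩ := (factorsThrough_iff f).1
    (factorsThrough_of_isSubmersion hp hn hp_conn (hf.mdifferentiable hn) hpf)
  exact ⟨g, contMDiff_of_comp_isSubmersion hp hp_surj hf, rfl⟩

end Descent

section Covector

variable {E : Type*} [NormedAddCommGroup E] [NormedSpace ℝ E] {H : Type*} [TopologicalSpace H]
  {I : ModelWithCorners ℝ E H} {Q : Type*} [TopologicalSpace Q] [ChartedSpace H Q]
  [IsManifold I ∞ Q]

/-- The coordinate of the covector `γ` in the preferred trivialization of `T^*Q` at `q`. At the
points over `q` it is the covector itself, seen as a functional on the model space `E`. -/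
noncomputable def CotangentBundle.covectorAt (q : Q) (γ : CotangentBundle I Q) : E →L[ℝ] ℝ :=
  (trivializationAt (E →L[ℝ] ℝ) (fun q : Q => TangentSpace I q →L[ℝ] ℝ) q γ).2

namespace CotangentBundle

theorem covectorAt_apply (q : Q) (γ : CotangentBundle I Q) (v : E) :
    covectorAt q γ v =
      γ.2 ((trivializationAt E (TangentSpace I : Q → Type _) q).symmL ℝ γ.1 v) := by
  have h : trivializationAt (E →L[ℝ] ℝ) (fun q : Q => TangentSpace I q →L[ℝ] ℝ) q γ = _ :=
    hom_trivializationAt_apply (σ := RingHom.id ℝ) (F₁ := E) (E₁ := (TangentSpace I : Q → Type _))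
      (F₂ := ℝ) (E₂ := fun _ : Q => ℝ) q γ
  rw [covectorAt, h]
  simp [ContinuousLinearMap.inCoordinates]

@[simp]
theorem covectorAt_mk (q : Q) (μ : TangentSpace I q →L[ℝ] ℝ) :
    covectorAt q (⟨q, μ⟩ : CotangentBundle I Q) = μ := by
  have : IsManifold I 1 Q := IsManifold.of_le (n := ∞) (by simp)
  refine ContinuousLinearMap.ext fun v => (covectorAt_apply q _ v).trans (congrArg μ ?_)
  rw [TangentBundle.symmL_trivializationAt (mem_chart_source H q),
    mfderivWithin_range_extChartAt_symm]
  rfl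

theorem eq_mk_iff {q : Q} {γ : CotangentBundle I Q} {μ : TangentSpace I q →L[ℝ] ℝ} :
    γ = ⟨q, μ⟩ ↔ γ.proj = q ∧ covectorAt q γ = μ := by
  constructor
  · rintro rfl
    exact ⟨rfl, covectorAt_mk q μ⟩
  · rintro ⟨rfl, hμ⟩
    exact congrArg (TotalSpace.mk γ.proj) ((covectorAt_mk _ γ.2).symm.trans hμ)

section Smooth

variable {E' : Type*} [NormedAddCommGroup E'] [NormedSpace ℝ E'] {H' : Type*} [TopologicalSpace H']
  {J : ModelWithCorners ℝ E' H'} {P : Type*} [TopologicalSpace P] [ChartedSpace H' P]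
  {n : WithTop ℕ∞} {f : P → CotangentBundle I Q} {x : P}

theorem contMDiffAt_iff :
    ContMDiffAt J (cotangentModel I) n f x ↔
      ContMDiffAt J I n (fun y => (f y).proj) x ∧
      ContMDiffAt J 𝓘(ℝ, E →L[ℝ] ℝ) n (fun y => covectorAt (f x).proj (f y)) x :=
  contMDiffAt_totalSpace

theorem contMDiff_mk (q : Q) :
    ContMDiff 𝓘(ℝ, E →L[ℝ] ℝ) (cotangentModel I) n
      (fun μ : E →L[ℝ] ℝ => (⟨q, μ⟩ : CotangentBundle I Q)) := by
  intro μ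
  have hid : (fun ν : E →L[ℝ] ℝ => covectorAt q (⟨q, ν⟩ : CotangentBundle I Q)) = id :=
    funext (covectorAt_mk q)
  exact contMDiffAt_iff.2 ⟨contMDiffAt_const, hid ▸ contMDiffAt_id⟩

end Smooth

end CotangentBundle

end Covector

section Upsilon

open CotangentBundle

variable {E : Type*} [NormedAddCommGroup E] [NormedSpace ℝ E] {H : Type*} [TopologicalSpace H]
  {I : ModelWithCorners ℝ E H} {M : Type*} [TopologicalSpace M] [ChartedSpace H M]
  [IsManifold I ∞ M]

theorem symmL_trivializationAt_prod {q₀ q : M × M}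
    (h₁ : q.1 ∈ (chartAt H q₀.1).source) (h₂ : q.2 ∈ (chartAt H q₀.2).source) (v : E × E) :
    (trivializationAt (E × E) (TangentSpace (I.prod I) : M × M → Type _) q₀).symmL ℝ q v =
      ((trivializationAt E (TangentSpace I : M → Type _) q₀.1).symmL ℝ q.1 v.1,
       (trivializationAt E (TangentSpace I : M → Type _) q₀.2).symmL ℝ q.2 v.2) := by
  have : IsManifold I 1 M := IsManifold.of_le (n := ∞) (by simp)
  rw [TangentBundle.symmL_trivializationAt h₁, TangentBundle.symmL_trivializationAt h₂,
    TangentBundle.symmL_trivializationAt (x₀ := q₀) (x := q)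
      (by rw [prodChartedSpace_chartAt]; exact ⟨h₁, h₂⟩)]
  have hchart : extChartAt (I.prod I) q₀ q = (extChartAt I q₀.1 q.1, extChartAt I q₀.2 q.2) := by
    rw [extChartAt_prod]; rfl
  have hsymm : ((extChartAt (I.prod I) q₀).symm : E × E → M × M)
      = Prod.map (extChartAt I q₀.1).symm (extChartAt I q₀.2).symm := by
    rw [extChartAt_prod]; rfl
  have hrange : range (I.prod I) = range I ×ˢ range I := range_prodMap
  have hprod := mfderivWithin_prodMap (I := 𝓘(ℝ, E)) (I' := 𝓘(ℝ, E)) (J := I) (J' := I)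
    (p := (extChartAt I q₀.1 q.1, extChartAt I q₀.2 q.2)) (s := range I) (t := range I)
    (f := (extChartAt I q₀.1).symm) (g := (extChartAt I q₀.2).symm)
    (mdifferentiableWithinAt_extChartAt_symm (by simp [h₁]))
    (mdifferentiableWithinAt_extChartAt_symm (by simp [h₂]))
    (I.uniqueDiffOn.uniqueMDiffOn _ (mem_range_self _))
    (I.uniqueDiffOn.uniqueMDiffOn _ (mem_range_self _))
  rw [hsymm, hchart, hrange, ← modelWithCornersSelf_prod, ← chartedSpaceSelf_prod] at *
  exact DFunLike.congr_fun hprod v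

theorem covectorAt_prod_apply {q₀ : M × M} {γ : CotangentBundle (I.prod I) (M × M)}
    (h₁ : γ.proj.1 ∈ (chartAt H q₀.1).source) (h₂ : γ.proj.2 ∈ (chartAt H q₀.2).source)
    (v : E × E) :
    covectorAt q₀ γ v = -covectorAt q₀.1 (upsilon I M γ).1 v.1 +
      covectorAt q₀.2 (upsilon I M γ).2 v.2 := by
  obtain ⟨z, rfl⟩ := (upsilon I M).symm.surjective γ
  rw [covectorAt_apply, Equiv.apply_symm_apply, covectorAt_apply, covectorAt_apply]
  exact congrArg ((-z.1.2).coprod z.2.2) (symmL_trivializationAt_prod h₁ h₂ v)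

theorem contMDiff_upsilon_symm :
    ContMDiff ((cotangentModel I).prod (cotangentModel I)) (cotangentModel (I.prod I)) ∞
      (upsilon I M).symm := by
  intro z₀
  obtain ⟨hproj₁, hcov₁⟩ := CotangentBundle.contMDiffAt_iff.1
    (contMDiffAt_fst : ContMDiffAt ((cotangentModel I).prod (cotangentModel I)) (cotangentModel I)
      ∞ (Prod.fst : CotangentBundle I M × CotangentBundle I M → _) z₀)
  obtain ⟨hproj₂, hcov₂⟩ := CotangentBundle.contMDiffAt_iff.1
    (contMDiffAt_snd : ContMDiffAt ((cotangentModel I).prod (cotangentModel I)) (cotangentModel I)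
      ∞ (Prod.snd : CotangentBundle I M × CotangentBundle I M → _) z₀)
  rw [CotangentBundle.contMDiffAt_iff]
  refine ⟨hproj₁.prodMk hproj₂, ?_⟩
  have hfst := hcov₁.clm_comp (contMDiffAt_const (c := ContinuousLinearMap.fst ℝ E E))
  have hsnd := hcov₂.clm_comp (contMDiffAt_const (c := ContinuousLinearMap.snd ℝ E E))
  refine (hfst.neg.add hsnd).congr_of_eventuallyEq ?_
  filter_upwards [hproj₁.continuousAt.eventually (chart_source_mem_nhds H _),
    hproj₂.continuousAt.eventually (chart_source_mem_nhds H _)] with z h₁ h₂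
  refine ContinuousLinearMap.ext fun v => ?_
  have h := covectorAt_prod_apply (I := I) (q₀ := ((upsilon I M).symm z₀).proj)
    (γ := (upsilon I M).symm z) h₁ h₂ v
  rw [Equiv.apply_symm_apply] at h
  exact h

theorem contMDiff_upsilon :
    ContMDiff (cotangentModel (I.prod I)) ((cotangentModel I).prod (cotangentModel I)) ∞
      (upsilon I M) := by
  intro γ₀
  obtain ⟨hproj, hcov⟩ := CotangentBundle.contMDiffAt_iff.1
    (contMDiffAt_id : ContMDiffAt (cotangentModel (I.prod I)) (cotangentModel (I.prod I))
      ∞ (id : CotangentBundle (I.prod I) (M × M) → _) γ₀)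
  have h₁ := hproj.fst.continuousAt.eventually (chart_source_mem_nhds H _)
  have h₂ := hproj.snd.continuousAt.eventually (chart_source_mem_nhds H _)
  have hinl := hcov.clm_comp (contMDiffAt_const (c := ContinuousLinearMap.inl ℝ E E))
  have hinr := hcov.clm_comp (contMDiffAt_const (c := ContinuousLinearMap.inr ℝ E E))
  refine ContMDiffAt.prodMk
    (CotangentBundle.contMDiffAt_iff.2 ⟨hproj.fst, hinl.neg.congr_of_eventuallyEq ?_⟩)
    (CotangentBundle.contMDiffAt_iff.2 ⟨hproj.snd, hinr.congr_of_eventuallyEq ?_⟩)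
  · filter_upwards [h₁, h₂] with γ h₁ h₂
    refine ContinuousLinearMap.ext fun v => ?_
    have h := covectorAt_prod_apply h₁ h₂ (v, 0)
    rw [map_zero, add_zero] at h
    exact neg_eq_iff_eq_neg.1 h.symm
  · filter_upwards [h₁, h₂] with γ h₁ h₂
    refine ContinuousLinearMap.ext fun v => ?_
    have h := covectorAt_prod_apply h₁ h₂ (0, v)
    rw [map_zero, neg_zero, zero_add] at h
    exact h.symm

end Upsilon

section Extensions

variable {E : Type*} [NormedAddCommGroup E] [NormedSpace ℝ E] {H : Type*} [TopologicalSpace H]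
  (I : ModelWithCorners ℝ E H) {Q : Type*} [TopologicalSpace Q] [ChartedSpace H Q]
  (F : Type*) [NormedAddCommGroup F] [NormedSpace ℝ F]
  {C : Type*} [TopologicalSpace C] [ChartedSpace F C] (j : C → Q) (f : C → ℝ) (c : C)

/-- The affine space of the covectors at `j c` that restrict to `df` on `T_c C`, seen as
functionals on the model space `E`; these spaces are the fibres of `Σ_f`. -/
def differentialExtensions : Set (E →L[ℝ] ℝ) :=
  {μ | ∀ v : F, μ (mfderiv 𝓘(ℝ, F) I j c v) = mfderiv 𝓘(ℝ, F) 𝓘(ℝ, ℝ) f c v}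

theorem convex_differentialExtensions : Convex ℝ (differentialExtensions I F j f c) := by
  intro μ hμ ν hν a b _ _ hab v
  exact (congrArg₂ (a • · + b • ·) (hμ v) (hν v)).trans (Convex.combo_self hab _)

variable {I F j f c}

theorem differentialExtensions_eq_preimage_precomp {μ : E →L[ℝ] ℝ}
    (hμ : μ ∈ differentialExtensions I F j f c) :
    letI R : (E →L[ℝ] ℝ) →L[ℝ] F →L[ℝ] ℝ :=
      ContinuousLinearMap.precomp ℝ (mfderiv 𝓘(ℝ, F) I j c : F →L[ℝ] E)
    differentialExtensions I F j f c = R ⁻¹' {R μ} :=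
  Set.ext fun _ => ⟨fun hν => ContinuousLinearMap.ext fun v => (hν v).trans (hμ v).symm,
    fun hν v => (DFunLike.congr_fun hν v).trans (hμ v)⟩

open CotangentBundle in
theorem mem_sigma_iff [IsManifold I ∞ Q] {γ : CotangentBundle I Q} :
    γ ∈ sigma I F j f ↔
      ∃ c : C, γ.proj = j c ∧ covectorAt (j c) γ ∈ differentialExtensions I F j f c := by
  constructor
  · rintro ⟨c, μ, rfl, hμ⟩
    exact ⟨c, rfl, fun v => (DFunLike.congr_fun (covectorAt_mk (j c) μ) _).trans (hμ v)⟩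
  · rintro ⟨c, hγ, hc⟩
    exact ⟨c, _, eq_mk_iff.2 ⟨hγ, rfl⟩, hc⟩

end Extensions

section GeneratingFunction

open CotangentBundle

variable {E : Type*} [NormedAddCommGroup E] [NormedSpace ℝ E] {H : Type*} [TopologicalSpace H]
  {I : ModelWithCorners ℝ E H} {Q : Type*} [TopologicalSpace Q] [ChartedSpace H Q]
  [IsManifold I ∞ Q]
  {G : Type*} [NormedAddCommGroup G] [NormedSpace ℝ G]
  {N : Type*} [TopologicalSpace N] [ChartedSpace G N]
  {F : Type*} [NormedAddCommGroup F] [NormedSpace ℝ F]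
  {C : Type*} [TopologicalSpace C] [ChartedSpace F C]
  {i : N → CotangentBundle I Q} {S : N → ℝ} {j : C → Q} {p : N → C} {f : C → ℝ} {x : N}

namespace IsGeneratingFunction

theorem covectorAt_mfderiv_mfderiv (hS : IsGeneratingFunction I G i S)
    (hi : MDifferentiableAt 𝓘(ℝ, G) (cotangentModel I) i x)
    (hj : MDifferentiableAt 𝓘(ℝ, F) I j (p x)) (hp : MDifferentiableAt 𝓘(ℝ, G) 𝓘(ℝ, F) p x)
    (hjp : ∀ y, j (p y) = (i y).proj) (v : TangentSpace 𝓘(ℝ, G) x) :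
    covectorAt (j (p x)) (i x) (mfderiv 𝓘(ℝ, F) I j (p x) (mfderiv 𝓘(ℝ, G) 𝓘(ℝ, F) p x v)) =
      mfderiv 𝓘(ℝ, G) 𝓘(ℝ, ℝ) S x v := by
  have hπ : MDifferentiableAt (cotangentModel I) I
      (TotalSpace.proj : CotangentBundle I Q → Q) (i x) :=
    (contMDiff_proj (n := 1) _ _).mdifferentiableAt (by simp)
  have hTπ := (hπ.hasMFDerivAt.comp x hi.hasMFDerivAt).mfderiv
  have hTj := (hj.hasMFDerivAt.comp x hp.hasMFDerivAt).mfderiv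
  rw [show TotalSpace.proj ∘ i = j ∘ p from funext fun y => (hjp y).symm] at hTπ
  have hcov : covectorAt (j (p x)) (i x) = (i x).2 := by
    rw [hjp]
    exact covectorAt_mk _ _
  exact ((congrArg (covectorAt (j (p x)) (i x)) (DFunLike.congr_fun (hTj.symm.trans hTπ) v)).trans
    (DFunLike.congr_fun hcov _)).trans (hS.2 x v)

theorem exists_contMDiff_descent (hS : IsGeneratingFunction I G i S)
    (hi : MDifferentiable 𝓘(ℝ, G) (cotangentModel I) i) (hj : MDifferentiable 𝓘(ℝ, F) I j)
    (hp : IsSubmersion 𝓘(ℝ, G) 𝓘(ℝ, F) ∞ p) (hp_surj : Surjective p)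
    (hp_conn : ∀ c, IsPreconnected (p ⁻¹' {c})) (hjp : ∀ y, j (p y) = (i y).proj) :
    ∃ f : C → ℝ, ContMDiff 𝓘(ℝ, F) 𝓘(ℝ, ℝ) ∞ f ∧ S = f ∘ p := by
  refine DiscreteMechanics.exists_contMDiff_descent hp (by simp) hp_surj hp_conn hS.1
    fun x v hv => ?_
  rw [← hS.covectorAt_mfderiv_mfderiv (hi x) (hj (p x))
    (hp.contMDiff.mdifferentiable (by simp) x) hjp v, hv, map_zero]
  exact map_zero _

theorem covectorAt_mem_differentialExtensions (hS : IsGeneratingFunction I G i (f ∘ p))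
    (hi : MDifferentiable 𝓘(ℝ, G) (cotangentModel I) i) (hj : MDifferentiable 𝓘(ℝ, F) I j)
    (hp : IsSubmersion 𝓘(ℝ, G) 𝓘(ℝ, F) ∞ p) (hjp : ∀ y, j (p y) = (i y).proj)
    (hf : MDifferentiable 𝓘(ℝ, F) 𝓘(ℝ, ℝ) f) (x : N) :
    covectorAt (j (p x)) (i x) ∈ differentialExtensions I F j f (p x) := by
  intro v
  have hpx : MDifferentiableAt 𝓘(ℝ, G) 𝓘(ℝ, F) p x := hp.contMDiff.mdifferentiable (by simp) x
  obtain ⟨w, rfl⟩ := surjective_mfderiv_of_isSubmersionAtOfComplement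
    (hp.isSubmersionOfComplement_complement x) (by simp) v
  have hpair := hS.covectorAt_mfderiv_mfderiv (hi x) (hj (p x)) hpx hjp w
  rw [mfderiv_comp x (hf (p x)) hpx] at hpair
  exact hpair

theorem range_subset_sigma (hS : IsGeneratingFunction I G i (f ∘ p))
    (hi : MDifferentiable 𝓘(ℝ, G) (cotangentModel I) i) (hj : MDifferentiable 𝓘(ℝ, F) I j)
    (hp : IsSubmersion 𝓘(ℝ, G) 𝓘(ℝ, F) ∞ p) (hjp : ∀ y, j (p y) = (i y).proj)
    (hf : MDifferentiable 𝓘(ℝ, F) 𝓘(ℝ, ℝ) f) : range i ⊆ sigma I F j f := by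
  rintro _ ⟨x, rfl⟩
  exact mem_sigma_iff.2
    ⟨p x, (hjp x).symm, hS.covectorAt_mem_differentialExtensions hi hj hp hjp hf x⟩

end IsGeneratingFunction

theorem exists_covector_parametrization (hi : ContMDiff 𝓘(ℝ, G) (cotangentModel I) ∞ i)
    (hi_inj : Injective (mfderiv 𝓘(ℝ, G) (cotangentModel I) i x))
    {K : Type*} [NormedAddCommGroup K] [NormedSpace ℝ K]
    (hp : IsSubmersionAtOfComplement K 𝓘(ℝ, G) 𝓘(ℝ, F) ∞ p x) (hjp : ∀ y, j (p y) = (i y).proj) :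
    ∃ (σ : K → N) (k₀ : K), σ k₀ = x ∧ (∀ᶠ k in 𝓝 k₀, p (σ k) = p x) ∧
      ContDiffAt ℝ ∞ (fun k => covectorAt (j (p x)) (i (σ k))) k₀ ∧
      Injective (fderiv ℝ (fun k => covectorAt (j (p x)) (i (σ k))) k₀) := by
  obtain ⟨σ, k₀, rfl, hσ_inj, hσ, -⟩ := exists_fiber_parametrization hp (by simp)
  have hσ₀ : ContMDiffAt 𝓘(ℝ, K) 𝓘(ℝ, G) ∞ σ k₀ := hσ.self_of_nhds.1
  have hpσ : ∀ᶠ k in 𝓝 k₀, p (σ k) = p (σ k₀) := hσ.mono fun k hk => hk.2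
  let φ : K → E →L[ℝ] ℝ := fun k => covectorAt (j (p (σ k₀))) (i (σ k))
  have hφ : ContDiffAt ℝ ∞ φ k₀ := by
    have h := (CotangentBundle.contMDiffAt_iff.1 ((hi (σ k₀)).comp k₀ hσ₀)).2
    rw [comp_apply, ← hjp] at h
    exact h.contDiffAt
  refine ⟨σ, k₀, rfl, hpσ, hφ, ?_⟩
  rw [← mfderiv_eq_fderiv]
  refine injective_mfderiv_of_comp (I₃ := cotangentModel I)
    ((contMDiff_mk (I := I) (n := 1) (j (p (σ k₀)))).mdifferentiableAt (by simp))
    (hφ.differentiableAt (by simp)).mdifferentiableAt ?_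
  have heq : (fun μ : E →L[ℝ] ℝ => (⟨j (p (σ k₀)), μ⟩ : CotangentBundle I Q)) ∘ φ
      =ᶠ[𝓝 k₀] i ∘ σ := by
    filter_upwards [hpσ] with k hk
    exact (eq_mk_iff.2 ⟨by rw [← hk]; exact (hjp _).symm, rfl⟩).symm
  rw [heq.mfderiv_eq, mfderiv_comp k₀ (hi.mdifferentiable (by simp) _)
    (hσ₀.mdifferentiableAt (by simp))]
  exact hi_inj.comp hσ_inj

theorem setOf_mk_mem_range_mem_nhdsWithin [FiniteDimensional ℝ E]
    (hi : ContMDiff 𝓘(ℝ, G) (cotangentModel I) ∞ i)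
    (hi_inj : Injective (mfderiv 𝓘(ℝ, G) (cotangentModel I) i x))
    (hp : IsSubmersion 𝓘(ℝ, G) 𝓘(ℝ, F) ∞ p) (hjp : ∀ y, j (p y) = (i y).proj)
    (hj_inj : Injective (mfderiv 𝓘(ℝ, F) I j (p x)))
    (hdim : Module.finrank ℝ G = Module.finrank ℝ E)
    (hf : ∀ y, covectorAt (j (p y)) (i y) ∈ differentialExtensions I F j f (p y)) :
    {μ : E →L[ℝ] ℝ | (⟨j (p x), μ⟩ : CotangentBundle I Q) ∈ range i} ∈
      𝓝[differentialExtensions I F j f (p x)] (covectorAt (j (p x)) (i x)) := by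
  have hsub := hp.isSubmersionOfComplement_complement x
  obtain ⟨σ, k₀, rfl, hpσ, hφ, hφ_inj⟩ := exists_covector_parametrization hi hi_inj hsub hjp
  let φ : hp.complement → E →L[ℝ] ℝ := fun k => covectorAt (j (p (σ k₀))) (i (σ k))
  let T : F →L[ℝ] E := mfderiv 𝓘(ℝ, F) I j (p (σ k₀))
  let R : (E →L[ℝ] ℝ) →L[ℝ] F →L[ℝ] ℝ := ContinuousLinearMap.precomp ℝ T
  have hA : differentialExtensions I F j f (p (σ k₀)) = R ⁻¹' {R (φ k₀)} :=
    differentialExtensions_eq_preimage_precomp (hf (σ k₀))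
  have hRφ : ∀ᶠ k in 𝓝 k₀, R (φ k) = R (φ k₀) := by
    filter_upwards [hpσ] with k hk
    have hφk := hf (σ k)
    rw [hk, hA] at hφk
    exact hφk
  have hR : Surjective R := surjective_precomp
    (ContinuousLinearMap.HasLeftInverse.of_injective_of_finiteDimensional hj_inj)
  have hdimK : Module.finrank ℝ hp.complement + Module.finrank ℝ (F →L[ℝ] ℝ) =
      Module.finrank ℝ (E →L[ℝ] ℝ) := by
    have : FiniteDimensional ℝ F := Module.Finite.of_injective T.toLinearMap hj_inj
    have : FiniteDimensional ℝ hp.complement :=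
      Module.Finite.of_injective (fderiv ℝ φ k₀).toLinearMap hφ_inj
    rw [finrank_continuousDual, finrank_continuousDual, ← hdim,
      hsub.equiv.toLinearEquiv.finrank_eq, Module.finrank_prod, add_comm]
  rw [hA]
  refine nhdsWithin_preimage_le_map_of_hasStrictFDerivAt (hφ.hasStrictFDerivAt (by simp))
    hφ_inj hR hRφ hdimK (mem_map.2 ?_)
  filter_upwards [hpσ] with k hk
  exact ⟨σ k, eq_mk_iff.2 ⟨by rw [← hk]; exact (hjp _).symm, rfl⟩⟩

theorem sigma_subset_range [FiniteDimensional ℝ E]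
    (hi : ContMDiff 𝓘(ℝ, G) (cotangentModel I) ∞ i)
    (hi_inj : ∀ x, Injective (mfderiv 𝓘(ℝ, G) (cotangentModel I) i x))
    (hp : IsSubmersion 𝓘(ℝ, G) 𝓘(ℝ, F) ∞ p) (hp_surj : Surjective p)
    (hjp : ∀ y, j (p y) = (i y).proj) (hj : Injective j)
    (hj_inj : ∀ c, Injective (mfderiv 𝓘(ℝ, F) I j c))
    (hdim : Module.finrank ℝ G = Module.finrank ℝ E)
    (hf : ∀ y, covectorAt (j (p y)) (i y) ∈ differentialExtensions I F j f (p y))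
    (hclosed : ∀ q : Q, IsClosed
      {μ : TangentSpace I q →L[ℝ] ℝ | (⟨q, μ⟩ : CotangentBundle I Q) ∈ range i}) :
    sigma I F j f ⊆ range i := by
  intro γ hγ
  obtain ⟨c, hγc, hc⟩ := mem_sigma_iff.1 hγ
  rw [eq_mk_iff.2 ⟨hγc, rfl⟩]
  refine subset_of_isPreconnected_of_isClosed
    (convex_differentialExtensions I F j f c).isPreconnected (hclosed (j c)) ?_ ?_ hc
  · obtain ⟨x, rfl⟩ := hp_surj c
    exact ⟨_, hf x, x, eq_mk_iff.2 ⟨(hjp x).symm, rfl⟩⟩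
  · rintro μ ⟨-, x, hx⟩
    obtain ⟨hxc, rfl⟩ := eq_mk_iff.1 hx
    obtain rfl : p x = c := hj ((hjp x).trans hxc)
    exact setOf_mk_mem_range_mem_nhdsWithin hi (hi_inj x) hp hjp (hj_inj (p x)) hdim hf

end GeneratingFunction

section Upsilon

variable {E : Type*} [NormedAddCommGroup E] [NormedSpace ℝ E] {H : Type*} [TopologicalSpace H]
  {I : ModelWithCorners ℝ E H} {M : Type*} [TopologicalSpace M] [ChartedSpace H M]
  [IsManifold I ∞ M] {G : Type*} [NormedAddCommGroup G] [NormedSpace ℝ G]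
  {L : Type*} [TopologicalSpace L] [ChartedSpace G L]
  {ι : L → CotangentBundle I M × CotangentBundle I M}

theorem injective_mfderiv_upsilon_symm_comp
    (hι : IsImmersion 𝓘(ℝ, G) ((cotangentModel I).prod (cotangentModel I)) ∞ ι) (x : L) :
    Injective (mfderiv 𝓘(ℝ, G) (cotangentModel (I.prod I)) ((upsilon I M).symm ∘ ι) x) := by
  have hsymm := contMDiff_upsilon_symm.comp hι.contMDiff
  refine injective_mfderiv_of_comp (contMDiff_upsilon.mdifferentiable (by simp) _)
    (hsymm.mdifferentiable (by simp) x) ?_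
  rw [← comp_assoc, Equiv.self_comp_symm, id_comp]
  exact injective_mfderiv_of_isImmersionAt (hι.isImmersionAt x) (by simp)

theorem IsLagrangianSubmanifold.finrank_eq [FiniteDimensional ℝ E]
    {Ω : ∀ z : CotangentBundle I M × CotangentBundle I M,
      TangentSpace ((cotangentModel I).prod (cotangentModel I)) z →
      TangentSpace ((cotangentModel I).prod (cotangentModel I)) z → ℝ}
    (hι : IsLagrangianSubmanifold ((cotangentModel I).prod (cotangentModel I)) Ω G ι) :
    Module.finrank ℝ G = Module.finrank ℝ (E × E) := by
  have hdim := hι.two_mul_dim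
  simp only [Module.finrank_prod, finrank_continuousDual] at hdim ⊢
  omega

end Upsilon

end DiscreteMechanics

open DiscreteMechanics in
theorem theorem5p1_general
    {E : Type*} [NormedAddCommGroup E] [NormedSpace ℝ E] [FiniteDimensional ℝ E]
    {H : Type*} [TopologicalSpace H] {I : ModelWithCorners ℝ E H}
    {M : Type*} [TopologicalSpace M] [ChartedSpace H M] [IsManifold I ∞ M]
    {G : Type*} [NormedAddCommGroup G] [NormedSpace ℝ G]
    {L : Type*} [TopologicalSpace L] [ChartedSpace G L]
    {ι : L → CotangentBundle I M × CotangentBundle I M}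
    (hι : IsImmersion 𝓘(ℝ, G) ((cotangentModel I).prod (cotangentModel I)) ∞ ι)
    (hdim : Module.finrank ℝ G = Module.finrank ℝ (E × E)) {S : L → ℝ}
    (hS : IsGeneratingFunction (I.prod I) G ((upsilon I M).symm ∘ ι) S)
    {F : Type*} [NormedAddCommGroup F] [NormedSpace ℝ F]
    {C : Type*} [TopologicalSpace C] [ChartedSpace F C]
    {j : C → M × M} (hj : IsImmersion 𝓘(ℝ, F) (I.prod I) ∞ j) (hj_inj : Function.Injective j)
    {p : L → C} (hp : ∀ x, j (p x) = ((upsilon I M).symm (ι x)).proj)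
    (hp_subm : IsSubmersion 𝓘(ℝ, G) 𝓘(ℝ, F) ∞ p) (hp_surj : Function.Surjective p)
    (hp_conn : ∀ c : C, IsPreconnected (p ⁻¹' {c})) :
    ∃ Ld : C → ℝ, ContMDiff 𝓘(ℝ, F) 𝓘(ℝ, ℝ) ∞ Ld ∧ (∀ x, S x = Ld (p x)) ∧
      upsilon I M ⁻¹' range ι ⊆ sigma (I.prod I) F j Ld ∧
      ((∀ q : M × M, IsClosed {μ : TangentSpace (I.prod I) q →L[ℝ] ℝ |
          (⟨q, μ⟩ : CotangentBundle (I.prod I) (M × M)) ∈ upsilon I M ⁻¹' range ι}) →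
        upsilon I M ⁻¹' range ι = sigma (I.prod I) F j Ld ∧
        range ι = discreteDynamics I F j Ld) := by
  have hi := contMDiff_upsilon_symm.comp hι.contMDiff
  have hi_diff := hi.mdifferentiable (by simp)
  have hj_diff := hj.contMDiff.mdifferentiable (by simp)
  have hrange : upsilon I M ⁻¹' range ι = range ((upsilon I M).symm ∘ ι) := by
    rw [range_comp, Equiv.image_symm_eq_preimage]
  obtain ⟨Ld, hLd, rfl⟩ := hS.exists_contMDiff_descent hi_diff hj_diff hp_subm hp_surj hp_conn hp
  have hLd_diff := hLd.mdifferentiable (by simp)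
  have hsub := hS.range_subset_sigma hi_diff hj_diff hp_subm hp hLd_diff
  rw [← hrange] at hsub
  refine ⟨Ld, hLd, fun _ => rfl, hsub, fun hclosed => ?_⟩
  have heq : upsilon I M ⁻¹' range ι = sigma (I.prod I) F j Ld := by
    refine hsub.antisymm ?_
    rw [hrange] at hclosed ⊢
    exact sigma_subset_range hi (injective_mfderiv_upsilon_symm_comp hι) hp_subm hp_surj hp hj_inj
      (fun c => injective_mfderiv_of_isImmersionAt (hj.isImmersionAt c) (by simp)) hdim
      (hS.covectorAt_mem_differentialExtensions hi_diff hj_diff hp_subm hp hLd_diff) hclosed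
  exact ⟨heq, by rw [discreteDynamics, ← heq, image_preimage_eq _ (upsilon I M).surjective]⟩

open DiscreteMechanics in
theorem theorem5p1
    {E : Type*} [NormedAddCommGroup E] [NormedSpace ℝ E] [FiniteDimensional ℝ E]
    {M : Type*} [TopologicalSpace M] [ChartedSpace E M] [IsManifold 𝓘(ℝ, E) ∞ M]
    -- the Lagrangian submanifold `Λ = range ι` of `(T^*M × T^*M, Ω)`
    {G : Type*} [NormedAddCommGroup G] [NormedSpace ℝ G] [FiniteDimensional ℝ G]
    {L : Type*} [TopologicalSpace L] [ChartedSpace G L] [IsManifold 𝓘(ℝ, G) ∞ L]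
    (ι : L → CotangentBundle 𝓘(ℝ, E) M × CotangentBundle 𝓘(ℝ, E) M)
    (hι : IsLagrangianSubmanifold
      ((cotangentModel 𝓘(ℝ, E)).prod (cotangentModel 𝓘(ℝ, E))) (productForm 𝓘(ℝ, E)) G ι)
    -- the generating function of `Υ⁻¹(Λ)`, whose inclusion is `Υ⁻¹ ∘ ι`
    (S : L → ℝ)
    (hS : IsGeneratingFunction (𝓘(ℝ, E).prod 𝓘(ℝ, E)) G ((upsilon 𝓘(ℝ, E) M).symm ∘ ι) S)
    -- the submanifold `C_d` of `M × M`, with inclusion `j`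
    {F : Type*} [NormedAddCommGroup F] [NormedSpace ℝ F] [FiniteDimensional ℝ F]
    {C : Type*} [TopologicalSpace C] [ChartedSpace F C] [IsManifold 𝓘(ℝ, F) ∞ C]
    (j : C → M × M) (hj : IsSmoothEmbedding 𝓘(ℝ, F) (𝓘(ℝ, E).prod 𝓘(ℝ, E)) ∞ j)
    -- the restriction `p` of `π_{M × M}` to `Υ⁻¹(Λ)`: a submersion onto `C_d`, connected fibres
    (p : L → C) (hp : ∀ x, j (p x) = ((upsilon 𝓘(ℝ, E) M).symm (ι x)).proj)
    (hp_subm : IsSubmersion 𝓘(ℝ, G) 𝓘(ℝ, F) ∞ p)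
    (hp_surj : Function.Surjective p)
    (hp_conn : ∀ c : C, IsConnected (p ⁻¹' {c})) :
    ∃ Ld : C → ℝ, ContMDiff 𝓘(ℝ, F) 𝓘(ℝ, ℝ) ∞ Ld ∧ (∀ x, S x = Ld (p x)) ∧
      upsilon 𝓘(ℝ, E) M ⁻¹' range ι ⊆ sigma (𝓘(ℝ, E).prod 𝓘(ℝ, E)) F j Ld ∧
      ((∀ q : M × M, IsClosed {μ : TangentSpace (𝓘(ℝ, E).prod 𝓘(ℝ, E)) q →L[ℝ] ℝ |
          (⟨q, μ⟩ : CotangentBundle (𝓘(ℝ, E).prod 𝓘(ℝ, E)) (M × M)) ∈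
            upsilon 𝓘(ℝ, E) M ⁻¹' range ι}) →
        upsilon 𝓘(ℝ, E) M ⁻¹' range ι = sigma (𝓘(ℝ, E).prod 𝓘(ℝ, E)) F j Ld ∧
        range ι = discreteDynamics 𝓘(ℝ, E) F j Ld) :=
  theorem5p1_general hι.isSmoothEmbedding.isImmersion hι.finrank_eq hS hj.isImmersion
    hj.isEmbedding.injective hp hp_subm hp_surj fun c => (hp_conn c).isPreconnected
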